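/- **Webs and their strings.** A *web* is an irreducible $A_2$-web: a bipartite plane graph without multiple edges, with a fixed black/white colouring, embedded in a disk, in which boundary vertices have degree $1$, interior vertices have degree $3$, and every internal face has at least $6$ sides. Let $D$ be a web with $k\ge 1$ boundary vertices, numbered clockwise from a chosen leftmost vertex $v=v_1$. The *signature and state string* of $D$ is the dominant string $((j_1,s_1),\dots,(j_k,s_k))$, where $s_i\in\{\bullet,\circ\}$ is the colour of $v_i$ and $j_i\in\{1,0,\bar 1\}$, from which the Khovanov–Kuperberg growth rules build $D$: put $v_1,\dots,v_k$ on a line from left to right, each with a hanging strand labelled $j_i$, and repeatedly replace two adjacent strands (a strand is written as its label and the colour of its upper vertex) by * a fork: $1^\bullet 0^\bullet\to\bar1^\circ$, $0^\bullet\bar1^\bullet\to1^\circ$, $1^\bullet\bar1^\bullet\to0^\circ$, $\bar1^\circ0^\circ\to1^\bullet$, $0^\circ1^\circ\to\bar1^\bullet$, $\bar1^\circ1^\circ\to0^\bullet$; * an H: $1^\bullet0^\circ\to0^\circ1^\bullet$, $0^\bullet0^\circ\to1^\circ1^\bullet$, $0^\bullet1^\circ\to1^\circ0^\bullet$, $\bar1^\circ0^\bullet\to0^\bullet\bar1^\circ$,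 $0^\circ0^\bullet\to\bar1^\bullet\bar1^\circ$, $0^\circ\bar1^\bullet\to\bar1^\bullet0^\circ$; * an arc: $1^\bullet1^\circ\to\varnothing$, $\bar1^\circ\bar1^\bullet\to\varnothing$, until no strand is left. *Dominant* means that the lattice path whose $i$-th step is $\pm$ the weight of $j_i$ ($+$ for $\bullet$, $-$ for $\circ$) stays in the dominant Weyl chamber of $\mathfrak{sl}_3$ and returns to the origin. **Tableaux.** The tableau *coming from* $D$ is the sequence $T=(\lambda^0,\dots,\lambda^k)$ in $\mathbb Z^3$ with $\lambda^0=(0,0,0)$ in which $\lambda^i$ is obtained from $\lambda^{i-1}$ by adding $1$ (if $s_i=\bullet$) or $-1$ (if $s_i=\circ$) to the first, second or third part according to $j_i=1,0,\bar1$. All $\lambda^i$ are weakly decreasing. The entry $i$ is written, unprimed or primed ($i'$) respectively, in the box that is added to or removed from $\lambda^{i-1}$; rows are numbered from top to bottom, and boxes of negative parts lie to the left of the axis. **Jeu de taquin step of generalized oscillating promotion.** Replace the entry $1$ (resp. $1'$) by $\bullet$ (resp. $\bullet'$). Then for $i=2,\dots,k$ in order, with $b$ the box of the bullet, $r_b$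 its row and $c_b$ its column: * bullet unprimed: if $i$ is unprimed and directly below or directly right of $b$, swap $i$ and $\bullet$; if $i'$ is in $b$, move both $i'$ and $\bullet$ to column $c_b-1$ of the bottommost row of $\lambda^i$ of size $\lambda^i_{r_b}$; otherwise do nothing; * bullet primed: if $i'$ is primed and directly above or directly left of $b$, swap $i'$ and $\bullet'$; if the unprimed $i$ is in $b$, move both $i$ and $\bullet'$ to column $c_b+1$ of the topmost row of $\lambda^i$ of size $\lambda^i_{r_b}$; otherwise do nothing. **Corollary.** Let $T=(\lambda^0,\dots,\lambda^k)$ come from a web $D$ with leftmost vertex $v$, and suppose that no component of $D$ is the identity web (a single edge joining two boundary vertices). 1. If $v$ is black, let $\lambda^a$ be the first partition with $a>0$ and $\lambda^a_1=\lambda^a_2$, and $\lambda^b$ the first partition with $b>a$ and $\lambda^b_2=\lambda^b_3$. Both exist, and for $2\le i\le k$ the entry $i$ (or $i'$) changes row during the jeu de taquin step if and only if $i\in\{a,b\}$. 2. If $v$ is white, let $\lambda^a$ be the first partition with $a>0$ and $\lambda^a_2=\lambda^a_3$, and $\lambda^b$ the first partition with $b>a$ and $\lambda^b_1=\lambda^b_2$.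 Both exist, and for $2\le i\le k$ the entry $i$ (or $i'$) changes row during the jeu de taquin step if and only if $i\in\{a,b\}$. 3. An entry that changes row moves up one row (from row $r$ to row $r-1$) if it is unprimed, and down one row (from row $r$ to row $r+1$) if it is primed. -/

import Mathlib

/-- Colours of the vertices of a web. -/
inductive WebColor
  | black
  | white
  deriving DecidableEq

/-- The states `1`, `0`, `-1`. -/
inductive WebState
  | one
  | zero
  | negOne
  deriving DecidableEq

/-- Irreducible `A₂`-webs with `k` boundary vertices and a chosen leftmost vertex (number `0`), up to
homeomorphism, as planar combinatorial maps. A dart is a half-edge, based at one vertex. The boundary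
vertices are numbered clockwise and `bdry i` is the unique dart based at the `i`-th one.

The permutation `rot` turns each dart based at an interior vertex to the next dart counterclockwise
around that vertex. On the boundary darts it is the cyclic shift: this is the rotation around the
point obtained by collapsing the boundary circle of the disk, so that `rot` and `opp` describe a graph
drawn on the sphere, whose faces are the faces of the web in the disk. -/
structure Web (k : ℕ) where
  Dart : Type
  [fintypeDart : Fintype Dart]
  /-- The other half of the same edge. -/
  opp : Equiv.Perm Dart
  opp_opp : ∀ d, opp (opp d) = d
  opp_ne : ∀ d, opp d ≠ d
  rot : Equiv.Perm Dart
  bdry : Fin k → Dart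
  bdry_injective : Function.Injective bdry
  rot_bdry : ∀ i, rot (bdry i) = bdry (finRotate k i)
  /-- Interior vertices have degree three. -/
  rot_interior : ∀ d, d ∉ Set.range bdry → rot d ≠ d ∧ rot (rot (rot d)) = d
  /-- The colour of the vertex at which a dart is based. -/
  color : Dart → WebColor
  color_rot : ∀ d, d ∉ Set.range bdry → color (rot d) = color d
  /-- The colouring is proper. -/
  color_opp : ∀ d, color (opp d) ≠ color d
  /-- There are no multiple edges. -/
  no_multiple_edges : ∀ d e,
    (d = e ∨ (d ∉ Set.range bdry ∧ rot.SameCycle d e)) →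
    (opp d = opp e ∨ (opp d ∉ Set.range bdry ∧ rot.SameCycle (opp d) (opp e))) → d = e
  /-- Planarity, as Euler's formula `2 V + 2 F = 2 E + 4 C` on the sphere: the faces are the cycles of
  `rot * opp` and `C` is the number of connected components. -/
  planar :
    2 * Nat.card (Quotient (Equiv.Perm.SameCycle.setoid rot))
        + 2 * Nat.card (Quotient (Equiv.Perm.SameCycle.setoid (rot * opp)))
      = Nat.card Dart
        + 4 * Nat.card (MulAction.orbitRel.Quotient (Subgroup.closure {rot, opp}) Dart)
  /-- Internal faces (those that do not touch the boundary) have at least six sides. -/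
  nonelliptic : ∀ d, (∀ i, ¬ (rot * opp).SameCycle d (bdry i)) →
    6 ≤ Function.minimalPeriod (rot * opp) d

namespace Web

/-- `D` contains the identity web as a component: some edge joins two boundary vertices. -/
def ContainsIdentity {k : ℕ} (D : Web k) : Prop :=
  ∃ i j, D.opp (D.bdry i) = D.bdry j

/-- Labels in the `Y`-shaped growth rules: two adjacent strands hanging from vertices of colour `c`,
labelled `a`, `b` from left to right, merge into one strand labelled `x`. -/
inductive YRule : (c : WebColor) → (a b x : WebState) → Prop
  | b1 : YRule .black .one .zero .negOne
  | b2 : YRule .black .zero .negOne .one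
  | b3 : YRule .black .one .negOne .zero
  | w1 : YRule .white .negOne .zero .one
  | w2 : YRule .white .zero .one .negOne
  | w3 : YRule .white .negOne .one .zero

/-- Labels in the `H`-shaped growth rules: adjacent strands labelled `a`, `b`, the left one hanging
from a vertex of colour `c` and the right one from a vertex of the other colour, are joined by a
horizontal edge and continue as strands labelled `x`, `y`. -/
inductive HRule : (c : WebColor) → (a b x y : WebState) → Prop
  | b1 : HRule .black .one .zero .zero .one
  | b2 : HRule .black .zero .zero .one .one
  | b3 : HRule .black .zero .one .one .zero
  | w1 : HRule .white .negOne .zero .zero .negOne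
  | w2 : HRule .white .zero .zero .negOne .negOne
  | w3 : HRule .white .zero .negOne .negOne .zero

/-- Labels in the arc rules: adjacent strands, both labelled `a`, the left one hanging from a vertex
of colour `c` and the right one from a vertex of the other colour, are joined. -/
inductive ArcRule : (c : WebColor) → (a : WebState) → Prop
  | b : ArcRule .black .one
  | w : ArcRule .white .negOne

/-- One step of the growth algorithm, as it draws the web `D`. The boundary vertices lie on a
horizontal line and the web grows downwards; the list holds, from left to right, the hanging strands:
a strand is the dart of `D` at its upper end, with the label of the edge. The vertices that a step
creates are interior vertices of `D`, with the cyclic order of the edges as in the drawing. -/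
inductive GrowthStep {k : ℕ} (D : Web k) :
    List (D.Dart × WebState) → List (D.Dart × WebState) → Prop
  | arc (L R : List (D.Dart × WebState)) (d e : D.Dart) (a : WebState)
      (hrule : ArcRule (D.color d) a) (hde : D.opp d = e) :
      GrowthStep D (L ++ (d, a) :: (e, a) :: R) (L ++ R)
  | fork (L R : List (D.Dart × WebState)) (d e : D.Dart) (a b x : WebState)
      (hrule : YRule (D.color d) a b x)
      (hd : D.opp d ∉ Set.range D.bdry)
      (hde : D.rot (D.opp e) = D.opp d) :
      GrowthStep D (L ++ (d, a) :: (e, b) :: R) (L ++ (D.rot (D.opp d), x) :: R)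
  | bridge (L R : List (D.Dart × WebState)) (d e : D.Dart) (a b x y : WebState)
      (hrule : HRule (D.color d) a b x y)
      (hd : D.opp d ∉ Set.range D.bdry) (he : D.opp e ∉ Set.range D.bdry)
      (hde : D.opp (D.rot (D.rot (D.opp d))) = D.rot (D.opp e)) :
      GrowthStep D (L ++ (d, a) :: (e, b) :: R)
        (L ++ (D.rot (D.opp d), x) :: (D.rot (D.rot (D.opp e)), y) :: R)

/-- The weight of a state and colour in the weight lattice of `sl(3)`, in the basis formed by the
weights of `(1, black)` and `(-1, white)`, which span the dominant chamber. -/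
def weight : WebState → WebColor → ℤ × ℤ
  | .one, .black => (1, 0)
  | .zero, .black => (-1, 1)
  | .negOne, .black => (0, -1)
  | .one, .white => (-1, 0)
  | .zero, .white => (1, -1)
  | .negOne, .white => (0, 1)

/-- A signature and state string is dominant if its lattice path stays in the dominant chamber and
ends at the origin. -/
def Dominant {k : ℕ} (s : Fin k → WebColor) (j : Fin k → WebState) : Prop :=
  (∀ m : ℕ, m ≤ k → 0 ≤ ∑ i : Fin k with i.val < m, weight (j i) (s i)) ∧
    ∑ i : Fin k, weight (j i) (s i) = 0

/-- The signature of `D`: the colours of its boundary vertices, from the leftmost one clockwise. -/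
def signature {k : ℕ} (D : Web k) : Fin k → WebColor := fun i => D.color (D.bdry i)

/-- `j`, together with the signature of `D`, is the signature and state string of `D`: it is dominant
and the growth algorithm applied to it draws `D`. (A complete run of the algorithm inside `D` reaches
all of `D`, and reaches each dart once.) -/
def IsStateString {k : ℕ} (D : Web k) (j : Fin k → WebState) : Prop :=
  Dominant D.signature j ∧
    Relation.ReflTransGen D.GrowthStep (List.ofFn fun i => (D.bdry i, j i)) []

end Web

/-- Generalized oscillating tableaux of length `k` with `n` parts. Rows are numbered from the top,
starting with `0`. The entry `i : Fin k` stands for the entry `i + 1` of the filling, which records the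
step from `part i.castSucc` to `part i.succ`; it is primed if this step removes a box. The fields `row`
and `primed` are determined by `part`. -/
structure GOT (k n : ℕ) where
  part : Fin (k + 1) → Fin n → ℤ
  part_zero : part 0 = 0
  part_antitone : ∀ i, Antitone (part i)
  row : Fin k → Fin n
  primed : Fin k → Bool
  part_succ : ∀ i, part i.succ =
    part i.castSucc + Pi.single (row i) (if primed i then (-1 : ℤ) else 1)

/-- The row of a generalized partition into which a state adds (or from which it removes) a box. -/
def WebState.row : WebState → Fin 3
  | .one => 0
  | .zero => 1
  | .negOne => 2

namespace GOT

variable {k n : ℕ}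

/-- `T` is the tableau of the web `D` with its chosen leftmost vertex: it is read off from the
signature and state string of `D`, black adding and white removing boxes. -/
def ComesFrom (T : GOT k 3) (D : Web k) : Prop :=
  ∃ j : Fin k → WebState, D.IsStateString j ∧
    ∀ i, T.row i = (j i).row ∧ (T.primed i = true ↔ D.signature i = .white)

/-- The box `(r, c)` that holds an entry in the filling of `T`. Here `r` is the row, and the column is
`c` if a part of size `c` has this box as its end and a part of size `c - 1` does not; thus the columns
`1, 2, …` are the positive ones and `0, -1, …` are the negative ones, from right to left. -/
def box (T : GOT k n) (i : Fin k) : Fin n × ℤ :=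
  (T.row i, if T.primed i then T.part i.castSucc (T.row i) else T.part i.succ (T.row i))

/-- The filling during promotion: the boxes of the entries and of the bullet. -/
structure Filling (k n : ℕ) where
  entry : Fin k → Fin n × ℤ
  bullet : Fin n × ℤ

/-- The bottommost row of `p` that has the same size as row `r`. -/
def bottomRow (p : Fin n → ℤ) (r : Fin n) : Fin n :=
  (Finset.univ.filter fun s => p s = p r).max' ⟨r, by simp⟩

/-- The topmost row of `p` that has the same size as row `r`. -/
def topRow (p : Fin n → ℤ) (r : Fin n) : Fin n :=
  (Finset.univ.filter fun s => p s = p r).min' ⟨r, by simp⟩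

/-- The jeu de taquin move for the entry `i`. The bullet is primed if the first entry of `T` is. Where
the bullet shares its box with `i`, both move by one column, to the extreme row of the same size in the
partition after step `i`, which is the present row if the next row has a different size. -/
def slide [NeZero k] (T : GOT k n) (i : Fin k) (F : Filling k n) : Filling k n :=
  let b := F.bullet
  let e := F.entry i
  if T.primed 0 = false then
    if T.primed i = false ∧
        ((e.1.val = b.1.val + 1 ∧ e.2 = b.2) ∨ (e.1 = b.1 ∧ e.2 = b.2 + 1)) then
      { entry := Function.update F.entry i b, bullet := e }
    else if T.primed i = true ∧ e = b then
      let b' := (bottomRow (T.part i.succ) b.1, b.2 - 1)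
      { entry := Function.update F.entry i b', bullet := b' }
    else F
  else
    if T.primed i = true ∧
        ((e.1.val + 1 = b.1.val ∧ e.2 = b.2) ∨ (e.1 = b.1 ∧ e.2 = b.2 - 1)) then
      { entry := Function.update F.entry i b, bullet := e }
    else if T.primed i = false ∧ e = b then
      let b' := (topRow (T.part i.succ) b.1, b.2 + 1)
      { entry := Function.update F.entry i b', bullet := b' }
    else F

/-- The first step of promotion: the bullet replaces the first entry. (The value of `entry` at the deleted
first entry plays no role.) -/
def startFilling [NeZero k] (T : GOT k n) : Filling k n where
  entry := T.box
  bullet := T.box 0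

/-- The filling after the jeu de taquin step of promotion: all entries but the first slide, in increasing order. -/
def slideAll [NeZero k] (T : GOT k n) : Filling k n :=
  (List.finRange k).tail.foldl (fun F i => T.slide i F) T.startFilling

/-- The row of an entry at the end of the jeu de taquin step of promotion. -/
def newRow [NeZero k] (T : GOT k n) (i : Fin k) : Fin n := (T.slideAll.entry i).1

/-- The entry `i` changes row during the jeu de taquin step of promotion. -/
def ChangesRow [NeZero k] (T : GOT k n) (i : Fin k) : Prop := T.newRow i ≠ T.row i

/-- `a` and `b` are the indices of the first partition after the initial empty one whose rows `p` and
`p + 1` have equal size, and of the first later one whose rows `q` and `q + 1` have equal size. -/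
def FirstEqualities (T : GOT k 3) (p q : Fin 2) (a b : Fin (k + 1)) : Prop :=
  IsLeast {i | 0 < i ∧ T.part i p.castSucc = T.part i p.succ} a ∧
    IsLeast {i | a < i ∧ T.part i q.castSucc = T.part i q.succ} b

end GOT

/-!
The bullet always occupies the last box of its row, and after each step this row is the bottommost
one of its size; so its path through the rows is found by iterating `bottomRow`, and an entry
changes row exactly when it trades rows with the bullet. An unprimed bullet starts in the first row.
It drops to the second one at `a`, and to the third one at `b`, provided that it does not drop
through both rows at once, that is, unless the lattice path is back at the origin at `a`.

In that case the path stays in the chamber translated by its first step until it takes the opposite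
step. No growth rule can combine only one of these two strands with a strand between them, because
the strands in between always form a closed dominant path. Hence the two strands are eventually
joined by an arc, which is an identity web.

Negating the partitions and reversing the rows exchanges the two colours, and turns the jeu de
taquin step by a half turn, which reduces a white leftmost vertex to a black one.
-/

section LatticePaths

variable {S G : Type*} [AddCommGroup G] [PartialOrder G]

/-- The path in a partially ordered group that starts at `p` and has the list `l` of steps visits
only nonnegative points. In the weight lattice, with the order of `ℤ × ℤ`, these are the dominant
weights. -/
def StaysNonneg (p : G) (l : List G) : Prop := ∀ m, 0 ≤ p + (l.take m).sum

@[simp]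
theorem staysNonneg_nil {p : G} : StaysNonneg p [] ↔ 0 ≤ p := by
  simp [StaysNonneg]

@[simp]
theorem staysNonneg_cons {p x : G} {l : List G} :
    StaysNonneg p (x :: l) ↔ 0 ≤ p ∧ StaysNonneg (p + x) l := by
  constructor
  · exact fun h => ⟨by simpa using h 0, fun m => by simpa [add_assoc] using h (m + 1)⟩
  · rintro ⟨hp, h⟩ (_ | m)
    · simpa using hp
    · simpa [add_assoc] using h m

theorem staysNonneg_append {p : G} {l l' : List G} :
    StaysNonneg p (l ++ l') ↔ StaysNonneg p l ∧ StaysNonneg (p + l.sum) l' := by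
  induction l generalizing p with
  | nil =>
    simp only [List.nil_append, staysNonneg_nil, List.sum_nil, add_zero, iff_and_self]
    exact fun h => by simpa using h 0
  | cons x l ih => simp [ih, and_assoc, add_assoc]

theorem StaysNonneg.add_sum_nonneg {p : G} {l : List G} (h : StaysNonneg p l) :
    0 ≤ p + l.sum := by
  simpa using h l.length

/-- The effect of a growth rule on weights: the consecutive steps `x`, `y` of a path are replaced by
`Z`, which keeps the endpoints and keeps the path dominant. The first two conditions prevent `x`
from being the last step, and `y` the first one, of a closed dominant path. -/
structure IsPathMove (x y : G) (Z : List G) : Prop where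
  left_not_nonpos : ¬ x ≤ 0
  right_not_nonneg : ¬ 0 ≤ y
  sum_eq : Z.sum = x + y
  staysNonneg : ∀ p, StaysNonneg p [x, y] → StaysNonneg p Z

theorem StaysNonneg.replace {p x y : G} {L R Z : List G} (h : StaysNonneg p (L ++ x :: y :: R))
    (hZ : IsPathMove x y Z) : StaysNonneg p (L ++ (Z ++ R)) := by
  rw [show x :: y :: R = [x, y] ++ R from rfl, staysNonneg_append, staysNonneg_append] at h
  rw [staysNonneg_append, staysNonneg_append, hZ.sum_eq]
  exact ⟨h.1, hZ.staysNonneg _ h.2.1, by simpa using h.2.2⟩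

/-- The list `l` of objects with weights `w` begins with `u` and has an occurrence of `v` such that
the steps in between form a closed path in the nonnegative cone. -/
def Encloses (w : S → G) (u v : S) (l : List S) : Prop :=
  ∃ X R, l = u :: (X ++ v :: R) ∧ StaysNonneg 0 (X.map w) ∧ (X.map w).sum = 0

variable {w : S → G} {u v : S} [IsOrderedAddMonoid G]

theorem encloses_ofFn {k : ℕ} {f : Fin k → S} [NeZero k] {n : Fin k} (hn : n ≠ 0)
    (hsum : Fin.partialSum (w ∘ f) n.castSucc = w (f 0))
    (hle : ∀ m : Fin (k + 1), 0 < m → m ≤ n.castSucc →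
      w (f 0) ≤ Fin.partialSum (w ∘ f) m) :
    Encloses w (f 0) (f n) (List.ofFn f) := by
  obtain _ | k := k
  · exact n.elim0
  obtain ⟨n, rfl⟩ := Fin.exists_succ_eq.2 hn
  set g : Fin k → S := Fin.tail f
  have htake (m : ℕ) (hm : m ≤ n) : w (f 0) + (((List.ofFn g).take m).map w).sum =
      Fin.partialSum (w ∘ f) ⟨m + 1, by omega⟩ := by
    rw [List.map_take, List.map_ofFn]
    exact (Fin.partialSum_succ' (w ∘ f) ⟨m, by omega⟩).symm
  refine ⟨(List.ofFn g).take n, (List.ofFn g).drop (n + 1), ?_, fun m => ?_, ?_⟩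
  · have hn : n.val < (List.ofFn g).length := by simp
    rw [List.ofFn_succ, show f n.succ = (List.ofFn g)[n.val] by simp [g, Fin.tail],
      ← List.drop_eq_getElem_cons hn, List.take_append_drop]
    rfl
  · rw [zero_add, ← List.map_take, List.take_take, ← add_le_add_iff_left (w (f 0)), add_zero,
      htake _ (min_le_right m n)]
    exact hle _ (Fin.lt_def.2 (by simp)) (Fin.le_def.2 (by simp))
  · exact add_eq_left.1 ((htake n le_rfl).trans hsum)

theorem StaysNonneg.last_nonpos {l : List G} {x : G} (h : StaysNonneg 0 (l ++ [x]))
    (hsum : (l ++ [x]).sum = 0) : x ≤ 0 := by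
  have hl : 0 ≤ l.sum := by simpa using (staysNonneg_append.1 h).1.add_sum_nonneg
  have hlx : l.sum + x = 0 := by simpa using hsum
  rw [eq_neg_of_add_eq_zero_right hlx]
  exact neg_nonpos.2 hl

/-- A move that involved exactly one of `u` and `v` would need `x` to be the last step, or `y` the
first step, of the enclosed closed path. -/
theorem Encloses.replace {L R Z : List S} {x y : S} (h : Encloses w u v (L ++ x :: y :: R))
    (hv : w v ≤ 0) (hZ : IsPathMove (w x) (w y) (Z.map w)) :
    (x = u ∧ y = v) ∨ Encloses w u v (L ++ (Z ++ R)) := by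
  obtain ⟨X, R', hl, hX, hX0⟩ := h
  have hxv : x ≠ v := fun h => hZ.left_not_nonpos (h ▸ hv)
  rcases L with _ | ⟨u', L⟩
  · rcases X with _ | ⟨y', X⟩
    · simp_all
    · obtain ⟨-, rfl, -⟩ : x = u ∧ y = y' ∧ R = X ++ v :: R' := by simpa using hl
      exact absurd (by simpa using hX 1) hZ.right_not_nonneg
  obtain ⟨rfl, hLX⟩ : u' = u ∧ L ++ x :: y :: R = X ++ v :: R' := by simpa using hl
  right
  rcases List.append_eq_append_iff.1 hLX with ⟨A, rfl, hA⟩ | ⟨C, rfl, hC⟩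
  · rcases A with _ | ⟨x', _ | ⟨y', A⟩⟩
    · simp_all
    · obtain ⟨rfl, -⟩ : x = x' ∧ y :: R = v :: R' := by simpa using hA
      rw [List.map_append] at hX hX0
      exact absurd (hX.last_nonpos hX0) hZ.left_not_nonpos
    · obtain ⟨rfl, rfl, rfl⟩ : x = x' ∧ y = y' ∧ R = A ++ v :: R' := by simpa using hA
      refine ⟨L ++ (Z ++ A), R', by simp, ?_, ?_⟩
      · simp only [List.map_append, List.map_cons] at hX ⊢
        exact hX.replace hZ
      · simpa [hZ.sum_eq, add_assoc] using hX0
  · rcases C with _ | ⟨v', C⟩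
    · simp_all
    · obtain ⟨rfl, rfl⟩ : v = v' ∧ R' = C ++ x :: y :: R := by simpa using hC
      exact ⟨X, C ++ (Z ++ R), by simp, hX, hX0⟩

end LatticePaths

theorem WebColor.eq_of_ne_of_ne {a b c : WebColor} (ha : a ≠ c) (hb : b ≠ c) : a = b := by
  cases a <;> cases b <;> cases c <;> simp_all

namespace Web

section Weights

variable {a b x y : WebState} {c c' : WebColor}

theorem weight_ne_zero (a : WebState) (c : WebColor) : weight a c ≠ 0 := by
  cases a <;> cases c <;> simp [weight]

theorem weight_eq_neg_of_le_neg (ha : 0 ≤ weight a c) (h : weight b c' ≤ -weight a c) :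
    weight b c' = -weight a c := by
  cases a <;> cases c <;> cases b <;> cases c' <;> simp_all [weight, Prod.le_def]

theorem ArcRule.isPathMove (h : ArcRule c a) (hc : c' ≠ c) :
    IsPathMove (weight a c) (weight a c') [] := by
  cases h <;> cases c' <;> first | exact absurd rfl hc | constructor
  all_goals simp [weight, Prod.le_def, Prod.ext_iff]

theorem YRule.isPathMove (h : YRule c a b x) (hc : c' ≠ c) :
    IsPathMove (weight a c) (weight b c) [weight x c'] := by
  have hsum : weight x c' = weight a c + weight b c := by
    cases h <;> cases c' <;> first | exact absurd rfl hc | rfl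
  refine ⟨?_, ?_, by simpa using hsum, fun p hp => ?_⟩
  · cases h <;> simp [weight, Prod.le_def]
  · cases h <;> simp [weight, Prod.le_def]
  · simp only [staysNonneg_cons, staysNonneg_nil] at hp ⊢
    exact ⟨hp.1, by simpa [hsum, add_assoc] using hp.2.2⟩

theorem HRule.isPathMove (h : HRule c a b x y) (hc : c' ≠ c) :
    IsPathMove (weight a c) (weight b c') [weight x c', weight y c] := by
  refine ⟨?_, ?_, ?_, fun p hp => ?_⟩
  · cases h <;> simp [weight, Prod.le_def]
  · cases h <;> cases c' <;> first | exact absurd rfl hc | simp [weight, Prod.le_def]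
  · cases h <;> cases c' <;> first | exact absurd rfl hc | simp [weight]
  · obtain ⟨p₁, p₂⟩ := p
    cases h <;> cases c' <;> first | exact absurd rfl hc | skip
    all_goals
      simp only [weight, staysNonneg_cons, staysNonneg_nil, Prod.mk_add_mk, Prod.le_def,
        Prod.fst_zero, Prod.snd_zero] at hp ⊢
      omega

theorem HRule.weight_ne_neg (h : HRule c a b x y) (hc : c' ≠ c) (ha : 0 ≤ weight a c) :
    weight b c' ≠ -weight a c := by
  cases h <;> cases c' <;> simp_all [weight, Prod.le_def]

theorem YRule.weight_ne_neg (h : YRule c a b x) : weight b c ≠ -weight a c := by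
  cases h <;> simp [weight]

end Weights

variable {k : ℕ} {D : Web k}

theorem rot_mem_range_bdry_iff {d : D.Dart} :
    D.rot d ∈ Set.range D.bdry ↔ d ∈ Set.range D.bdry := by
  constructor
  · rintro ⟨i, hi⟩
    refine ⟨(finRotate k).symm i, D.rot.injective ?_⟩
    rw [D.rot_bdry, Equiv.apply_symm_apply, hi]
  · rintro ⟨i, rfl⟩
    exact ⟨_, (D.rot_bdry i).symm⟩

theorem color_rot_opp_ne {d : D.Dart} (hd : D.opp d ∉ Set.range D.bdry) :
    D.color (D.rot (D.opp d)) ≠ D.color d := by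
  rw [D.color_rot _ hd]
  exact D.color_opp d

theorem color_rot_rot_opp_ne {d : D.Dart} (hd : D.opp d ∉ Set.range D.bdry) :
    D.color (D.rot (D.rot (D.opp d))) ≠ D.color d := by
  rw [D.color_rot _ (mt rot_mem_range_bdry_iff.1 hd)]
  exact color_rot_opp_ne hd

/-- The weight of the label of a hanging strand, with the colour of its upper vertex. -/
def strandWeight (D : Web k) (s : D.Dart × WebState) : ℤ × ℤ := weight s.2 (D.color s.1)

theorem GrowthStep.exists_isPathMove {l l' : List (D.Dart × WebState)} (h : D.GrowthStep l l') :
    ∃ L R s t Z, l = L ++ s :: t :: R ∧ l' = L ++ (Z ++ R) ∧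
      IsPathMove (D.strandWeight s) (D.strandWeight t) (Z.map D.strandWeight) ∧
      (0 ≤ D.strandWeight s → D.strandWeight t = -D.strandWeight s → D.opp s.1 = t.1) := by
  cases h with
  | arc L R d e a hrule hde =>
    exact ⟨L, R, (d, a), (e, a), [], rfl, rfl, hrule.isPathMove (hde ▸ D.color_opp d),
      fun _ _ => hde⟩
  | fork L R d e a b x hrule hd hde =>
    have he : D.opp e ∉ Set.range D.bdry := fun h => hd (hde ▸ rot_mem_range_bdry_iff.2 h)
    have hc : D.color e = D.color d :=
      WebColor.eq_of_ne_of_ne (hde ▸ color_rot_opp_ne he).symm (D.color_opp d).symm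
    refine ⟨L, R, (d, a), (e, b), [(D.rot (D.opp d), x)], rfl, rfl, ?_, ?_⟩ <;>
      simp only [strandWeight, List.map_cons, List.map_nil, hc]
    · exact hrule.isPathMove (color_rot_opp_ne hd)
    · exact fun _ h => absurd h hrule.weight_ne_neg
  | bridge L R d e a b x y hrule hd he hde =>
    have hc : D.color e ≠ D.color d := fun h => D.color_opp (D.rot (D.rot (D.opp d))) <|
      WebColor.eq_of_ne_of_ne (hde ▸ h ▸ color_rot_opp_ne he) (color_rot_rot_opp_ne hd)
    have hx := WebColor.eq_of_ne_of_ne (color_rot_opp_ne hd) hc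
    have hy := WebColor.eq_of_ne_of_ne (color_rot_rot_opp_ne he) hc.symm
    refine ⟨L, R, (d, a), (e, b), [(D.rot (D.opp d), x), (D.rot (D.rot (D.opp e)), y)],
      rfl, rfl, ?_, ?_⟩ <;> simp only [strandWeight, List.map_cons, List.map_nil, hx, hy]
    · exact hrule.isPathMove hc
    · exact fun ha h => absurd h (hrule.weight_ne_neg hc ha)

theorem opp_eq_of_encloses {l : List (D.Dart × WebState)} {u v : D.Dart × WebState}
    (hrun : Relation.ReflTransGen D.GrowthStep l []) (hl : Encloses D.strandWeight u v l)
    (hu : 0 ≤ D.strandWeight u) (hv : D.strandWeight v = -D.strandWeight u) :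
    D.opp u.1 = v.1 := by
  induction hrun using Relation.ReflTransGen.head_induction_on with
  | refl =>
    obtain ⟨X, R, h, -⟩ := hl
    simp at h
  | head hstep _ ih =>
    obtain ⟨L, R, s, t, Z, rfl, rfl, hZ, hjoin⟩ := hstep.exists_isPathMove
    rcases hl.replace (hv ▸ neg_nonpos.2 hu) hZ with ⟨rfl, rfl⟩ | h
    · exact hjoin hu hv
    · exact ih h

theorem Dominant.partialSum_nonneg {s : Fin k → WebColor} {j : Fin k → WebState}
    (h : Dominant s j) (m : Fin (k + 1)) :
    0 ≤ Fin.partialSum (fun i => weight (j i) (s i)) m := by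
  rw [Fin.partialSum, List.sum_take_ofFn]
  exact h.1 m (Nat.lt_succ_iff.1 m.isLt)

theorem Dominant.partialSum_last {s : Fin k → WebColor} {j : Fin k → WebState}
    (h : Dominant s j) : Fin.partialSum (fun i => weight (j i) (s i)) (Fin.last k) = 0 := by
  rw [Fin.partialSum, Fin.val_last, List.take_of_length_le (List.length_ofFn).le, List.sum_ofFn]
  exact h.2

theorem IsStateString.opp_bdry_zero [NeZero k] {j : Fin k → WebState} (hj : D.IsStateString j)
    {n : Fin k} (hn : Fin.partialSum (fun i => weight (j i) (D.signature i)) n.succ = 0)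
    (hle : ∀ m : Fin (k + 1), 0 < m → m < n.succ → weight (j 0) (D.signature 0) ≤
      Fin.partialSum (fun i => weight (j i) (D.signature i)) m) :
    D.opp (D.bdry 0) = D.bdry n := by
  set P := Fin.partialSum fun i => weight (j i) (D.signature i)
  have hstep (i : Fin k) : P i.succ = P i.castSucc + weight (j i) (D.signature i) :=
    Fin.partialSum_succ _ i
  have hfirst : P (0 : Fin k).succ = weight (j 0) (D.signature 0) := by
    rw [hstep, show P (0 : Fin k).castSucc = 0 from Fin.partialSum_zero _, zero_add]
  have hn0 : n ≠ 0 := fun h => weight_ne_zero _ _ (hfirst ▸ h ▸ hn)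
  have hdom : 0 ≤ weight (j 0) (D.signature 0) :=
    hfirst ▸ hj.1.partialSum_nonneg _
  have hend : P n.castSucc + weight (j n) (D.signature n) = 0 := (hstep n).symm.trans hn
  have hlen := hle n.castSucc (Fin.castSucc_pos_iff.2 (Fin.pos_iff_ne_zero.2 hn0))
    Fin.castSucc_lt_succ
  have hopp : weight (j n) (D.signature n) = -weight (j 0) (D.signature 0) :=
    weight_eq_neg_of_le_neg hdom (by rw [eq_neg_of_add_eq_zero_right hend]; exact neg_le_neg hlen)
  have hsum : P n.castSucc = weight (j 0) (D.signature 0) := by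
    rw [eq_neg_of_add_eq_zero_left hend, hopp, neg_neg]
  refine opp_eq_of_encloses (u := (D.bdry 0, j 0)) (v := (D.bdry n, j n)) hj.2 ?_ hdom hopp
  exact encloses_ofFn (w := D.strandWeight) (f := fun i => (D.bdry i, j i)) hn0 hsum
    fun m hm hmn => hle m hm (hmn.trans_lt Fin.castSucc_lt_succ)

end Web

theorem foldl_fin_induction {α : Type*} {k : ℕ} {P : Fin (k + 1) → α → Prop}
    {f : α → Fin k → α} {x : α} (zero : P 0 x)
    (succ : ∀ i y, P i.castSucc y → P i.succ (f y i)) : P (Fin.last k) (Fin.foldl k f x) := by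
  induction k with
  | zero => simpa using zero
  | succ k ih =>
    rw [Fin.foldl_succ_last]
    exact succ (Fin.last k) _ (ih (P := fun m => P m.castSucc) zero fun i => succ i.castSucc)

namespace GOT

section ExtremeRows

variable {n : ℕ} {p : Fin n → ℤ} {r s : Fin n}

theorem apply_bottomRow (p : Fin n → ℤ) (r : Fin n) : p (bottomRow p r) = p r :=
  (Finset.mem_filter.1 (Finset.max'_mem (Finset.univ.filter fun s => p s = p r) _)).2

theorem le_bottomRow (h : p s = p r) : s ≤ bottomRow p r :=
  Finset.le_max' _ _ (by simpa using h)

theorem bottomRow_congr (h : p s = p r) : bottomRow p s = bottomRow p r := by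
  simp only [bottomRow, h]

theorem apply_lt_of_bottomRow_lt (hp : Antitone p) (h : bottomRow p r < s) : p s < p r :=
  lt_of_le_of_ne (apply_bottomRow p r ▸ hp h.le) fun hs => h.not_ge (le_bottomRow hs)

theorem bottomRow_eq_of_lt (hs : p s = p r) (h : ∀ t, s < t → p t < p r) : bottomRow p r = s :=
  le_antisymm (not_lt.1 fun hlt => (h _ hlt).ne (apply_bottomRow p r)) (le_bottomRow hs)

theorem bottomRow_castSucc_of_ne {n : ℕ} {p : Fin (n + 1) → ℤ} (hp : Antitone p) {r : Fin n}
    (h : p r.castSucc ≠ p r.succ) : bottomRow p r.castSucc = r.castSucc :=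
  bottomRow_eq_of_lt rfl fun _ ht => (hp (Fin.castSucc_lt_iff_succ_le.1 ht)).trans_lt
    (lt_of_le_of_ne (hp Fin.castSucc_lt_succ.le) h.symm)

theorem topRow_neg_rev (p : Fin n → ℤ) (r : Fin n) :
    topRow (fun s => -p s.rev) r.rev = (bottomRow p r).rev := by
  refine le_antisymm (Finset.min'_le _ _ (by simp [apply_bottomRow]))
    (Finset.le_min' _ _ _ fun s hs => ?_)
  rw [Fin.rev_le_iff]
  exact le_bottomRow (by simpa using hs)

theorem bottomRow_neg_rev (p : Fin n → ℤ) (r : Fin n) :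
    bottomRow (fun s => -p s.rev) r.rev = (topRow p r).rev := by
  rw [← Fin.rev_inj, ← topRow_neg_rev]
  simp

end ExtremeRows

variable {k n : ℕ}

theorem part_succ_row (T : GOT k n) (i : Fin k) :
    T.part i.succ (T.row i) =
      T.part i.castSucc (T.row i) + if T.primed i then (-1 : ℤ) else 1 := by
  rw [T.part_succ]
  simp

theorem part_succ_of_ne (T : GOT k n) {i : Fin k} {r : Fin n} (h : r ≠ T.row i) :
    T.part i.succ r = T.part i.castSucc r := by
  rw [T.part_succ]
  simp [h]

section Dual

/-- The dual tableau: all partitions are negated, with the order of the rows reversed. Duality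
exchanges primed and unprimed entries and turns the pictures of the fillings by a half turn. -/
def dual (T : GOT k n) : GOT k n where
  part i r := -T.part i r.rev
  part_zero := by ext; simp [T.part_zero]
  part_antitone i _ _ h := neg_le_neg (T.part_antitone i (Fin.rev_le_rev.2 h))
  row i := (T.row i).rev
  primed i := !T.primed i
  part_succ i := by
    ext r
    rcases eq_or_ne r.rev (T.row i) with h | h
    · rw [Pi.add_apply, h, T.part_succ_row, ← h, Fin.rev_rev, Pi.single_eq_same]
      cases T.primed i <;> simp [add_comm]
    · rw [Pi.add_apply, T.part_succ_of_ne h,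
        Pi.single_eq_of_ne fun hr => h (by rw [hr, Fin.rev_rev]), add_zero]

/-- The half turn of the plane that takes the filling of a tableau to that of its dual. Column `1`
goes to column `0`, the first one on the other side of the axis. -/
def boxDual (b : Fin n × ℤ) : Fin n × ℤ := (b.1.rev, 1 - b.2)

/-- The half turn of a filling. -/
def Filling.dual (F : Filling k n) : Filling k n where
  entry i := boxDual (F.entry i)
  bullet := boxDual F.bullet

theorem Filling.ext {F F' : Filling k n} (hentry : F.entry = F'.entry)
    (hbullet : F.bullet = F'.bullet) : F = F' := by
  cases F
  cases F'
  simp_all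

theorem boxDual_injective : Function.Injective (boxDual (n := n)) := by
  rintro ⟨r, c⟩ ⟨s, d⟩ h
  simpa [boxDual] using h

theorem boxDual_above_or_left_iff {e b : Fin n × ℤ} :
    (((boxDual e).1.val + 1 = (boxDual b).1.val ∧ (boxDual e).2 = (boxDual b).2) ∨
        ((boxDual e).1 = (boxDual b).1 ∧ (boxDual e).2 = (boxDual b).2 - 1)) ↔
      (e.1.val = b.1.val + 1 ∧ e.2 = b.2) ∨ (e.1 = b.1 ∧ e.2 = b.2 + 1) := by
  simp only [boxDual, Fin.rev_inj, Fin.val_rev]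
  omega

theorem boxDual_below_or_right_iff {e b : Fin n × ℤ} :
    (((boxDual e).1.val = (boxDual b).1.val + 1 ∧ (boxDual e).2 = (boxDual b).2) ∨
        ((boxDual e).1 = (boxDual b).1 ∧ (boxDual e).2 = (boxDual b).2 + 1)) ↔
      (e.1.val + 1 = b.1.val ∧ e.2 = b.2) ∨ (e.1 = b.1 ∧ e.2 = b.2 - 1) := by
  simp only [boxDual, Fin.rev_inj, Fin.val_rev]
  omega

theorem box_dual (T : GOT k n) (i : Fin k) : T.dual.box i = boxDual (T.box i) := by
  have := T.part_succ_row i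
  refine Prod.ext rfl ?_
  cases h : T.primed i <;>
    simp only [box, boxDual, dual, h, Bool.not_true, Bool.not_false, Bool.false_eq_true, if_true,
      if_false, Fin.rev_rev] at this ⊢ <;>
    omega

theorem Filling.dual_update (F : Filling k n) (i : Fin k) (b b' : Fin n × ℤ) :
    (⟨Function.update F.entry i b, b'⟩ : Filling k n).dual =
      ⟨Function.update F.dual.entry i (boxDual b), boxDual b'⟩ := by
  refine Filling.ext (funext fun j => ?_) rfl
  rcases eq_or_ne j i with rfl | h <;> simp [Filling.dual, *]

variable [NeZero k]

theorem slide_dual (T : GOT k n) (i : Fin k) (F : Filling k n) :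
    T.dual.slide i F.dual = (T.slide i F).dual := by
  have hentry : F.dual.entry i = boxDual (F.entry i) := rfl
  have hbullet : F.dual.bullet = boxDual F.bullet := rfl
  have hprimed (j : Fin k) : T.dual.primed j = !T.primed j := rfl
  have hsame : boxDual (F.entry i) = boxDual F.bullet ↔ F.entry i = F.bullet :=
    boxDual_injective.eq_iff
  have hbottom : (bottomRow (T.dual.part i.succ) (boxDual F.bullet).1, (boxDual F.bullet).2 - 1) =
      boxDual (topRow (T.part i.succ) F.bullet.1, F.bullet.2 + 1) :=
    Prod.ext (bottomRow_neg_rev _ _) (sub_sub 1 F.bullet.2 1)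
  have htop : (topRow (T.dual.part i.succ) (boxDual F.bullet).1, (boxDual F.bullet).2 + 1) =
      boxDual (bottomRow (T.part i.succ) F.bullet.1, F.bullet.2 - 1) :=
    Prod.ext (topRow_neg_rev _ _) (sub_add 1 F.bullet.2 1)
  cases h0 : T.primed 0 <;> cases hi : T.primed i <;>
    simp only [slide, hentry, hbullet, hprimed, hsame, h0, hi, Bool.not_true, Bool.not_false,
      Bool.true_eq_false, Bool.false_eq_true, true_and, false_and, if_true, if_false, hbottom, htop,
      boxDual_above_or_left_iff, boxDual_below_or_right_iff, apply_ite Filling.dual,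
      Filling.dual_update]

theorem slideAll_dual (T : GOT k n) : T.dual.slideAll = T.slideAll.dual := by
  have hstart : T.dual.startFilling = T.startFilling.dual := by
    simp only [startFilling, box_dual, Filling.dual]
    congr
    exact funext T.box_dual
  rw [slideAll, slideAll, hstart]
  exact List.foldl_hom Filling.dual fun F i => T.slide_dual i F

theorem newRow_dual (T : GOT k n) (i : Fin k) : T.dual.newRow i = (T.newRow i).rev := by
  rw [newRow, slideAll_dual]
  rfl

theorem changesRow_dual (T : GOT k n) (i : Fin k) : T.dual.ChangesRow i ↔ T.ChangesRow i := by
  rw [ChangesRow, newRow_dual]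
  exact Fin.rev_inj.not

end Dual

section BulletRow

theorem bottomRow_succ_of_primed (T : GOT k n) {i : Fin k} {r : Fin n}
    (hr : bottomRow (T.part i.castSucc) r = r) (hi : T.primed i = true) (hrow : T.row i ≠ r) :
    bottomRow (T.part i.succ) r = r := by
  refine bottomRow_eq_of_lt rfl fun t ht => ?_
  rw [T.part_succ_of_ne hrow.symm]
  refine lt_of_le_of_lt ?_ (apply_lt_of_bottomRow_lt (T.part_antitone _) (hr.symm ▸ ht))
  rcases eq_or_ne t (T.row i) with rfl | hti
  · simp [T.part_succ_row, hi]
  · exact (T.part_succ_of_ne hti).le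

theorem bottomRow_succ_of_unprimed (T : GOT k n) {i : Fin k} {r : Fin n}
    (hr : bottomRow (T.part i.castSucc) r = r) (hi : T.primed i = false) :
    bottomRow (T.part i.succ) r =
      if (T.row i).val = r.val + 1 ∧ T.part i.succ (T.row i) = T.part i.castSucc r
        then T.row i else r := by
  have hlt {t : Fin n} (ht : r < t) : T.part i.castSucc t < T.part i.castSucc r :=
    apply_lt_of_bottomRow_lt (T.part_antitone _) (hr.symm ▸ ht)
  split_ifs with h
  · have hrow : r ≠ T.row i := fun hr => by omega
    have hpart := T.part_succ_of_ne hrow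
    refine bottomRow_eq_of_lt (h.2.trans hpart.symm) fun t ht => ?_
    rw [T.part_succ_of_ne ht.ne', hpart]
    exact hlt (lt_trans (by omega) ht)
  · refine bottomRow_eq_of_lt rfl fun t ht => ?_
    rcases eq_or_ne r (T.row i) with hrow | hrow
    · rw [T.part_succ_of_ne (hrow ▸ ht.ne')]
      refine (hlt ht).trans_le ?_
      rw [hrow, T.part_succ_row, hi]
      simp
    refine lt_of_le_of_ne (T.part_antitone _ ht.le) fun heq => h ?_
    rw [T.part_succ_of_ne hrow] at heq
    have hti : t = T.row i := by_contra fun hti => (hlt ht).ne (T.part_succ_of_ne hti ▸ heq)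
    refine ⟨hti ▸ le_antisymm ?_ ht, hti ▸ heq⟩
    by_contra! hgap
    let next : Fin n := ⟨r + 1, by omega⟩
    have hnext : next ≠ T.row i := Fin.ne_of_val_ne (by rw [← hti]; exact hgap.ne)
    refine (hlt (t := next) (Fin.lt_def.2 (Nat.lt_succ_self _))).not_ge ?_
    rw [← heq, ← T.part_succ_of_ne hnext]
    exact T.part_antitone _ (Fin.le_def.2 hgap.le)

variable [NeZero k] {T : GOT k n}

theorem slide_entry_of_ne {i j : Fin k} (h : j ≠ i) (F : Filling k n) :
    (T.slide i F).entry j = F.entry j := by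
  simp only [slide]
  split_ifs <;> simp [h]

variable (h0 : T.primed 0 = false)

include h0

theorem slide_bullet_and_entry {i : Fin k} {F : Filling k n} {r : Fin n}
    (hentry : F.entry i = T.box i) (hbullet : F.bullet = (r, T.part i.castSucc r))
    (hr : bottomRow (T.part i.castSucc) r = r) :
    (T.slide i F).bullet =
        (bottomRow (T.part i.succ) r, T.part i.succ (bottomRow (T.part i.succ) r)) ∧
      ((T.slide i F).entry i).1 = Equiv.swap r (bottomRow (T.part i.succ) r) (T.row i) := by
  have hstep := T.part_succ_row i
  cases hi : T.primed i
  · have hbox : T.box i = (T.row i, T.part i.succ (T.row i)) := by simp [box, hi]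
    have hright : (T.row i = r ∧ T.part i.succ (T.row i) = T.part i.castSucc r + 1) ↔
        T.row i = r := and_iff_left_of_imp fun h => by simpa [hi, h] using hstep
    have hslide : T.slide i F =
        if ((T.row i).val = r.val + 1 ∧ T.part i.succ (T.row i) = T.part i.castSucc r) ∨
          T.row i = r
        then ⟨Function.update F.entry i F.bullet, T.box i⟩ else F := by
      simp [slide, h0, hi, hentry, hbox, hbullet, hright]
    rw [T.bottomRow_succ_of_unprimed hr hi, hslide]
    by_cases hbelow : (T.row i).val = r.val + 1 ∧ T.part i.succ (T.row i) = T.part i.castSucc r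
    · simp [hbelow, hbox, hbullet]
    by_cases hrow : T.row i = r
    · rw [if_neg hbelow, if_pos (.inr hrow), hbox, hbullet, hrow]
      simp
    · rw [if_neg hbelow, if_neg (not_or_intro hbelow hrow), T.part_succ_of_ne (Ne.symm hrow),
        hentry, hbox]
      simp [hbullet]
  · have hbox : T.box i = (T.row i, T.part i.castSucc (T.row i)) := by simp [box, hi]
    have hslide : T.slide i F = if F.entry i = F.bullet then
        let b := (bottomRow (T.part i.succ) F.bullet.1, F.bullet.2 - 1)
        ⟨Function.update F.entry i b, b⟩ else F := by simp [slide, h0, hi]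
    by_cases hrow : T.row i = r
    · rw [hslide, if_pos (by rw [hentry, hbox, hbullet, hrow]), hbullet,
        apply_bottomRow (T.part i.succ) r, ← hrow, hstep, hi]
      simp [sub_eq_add_neg]
    · rw [hslide, if_neg fun h => hrow (by simpa [hentry, hbox, hbullet] using congrArg Prod.fst h),
        T.bottomRow_succ_of_primed hr hi hrow, T.part_succ_of_ne (Ne.symm hrow), hentry, hbox]
      simp [hbullet]

omit h0

/-- The row of an unprimed bullet after the moves for the first `m` entries: at every step it goes
to the bottommost row of the same size. -/
def bulletRow (T : GOT k n) : Fin (k + 1) → Fin n :=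
  Fin.induction (T.row 0) fun i r => bottomRow (T.part i.succ) r

theorem bulletRow_zero (T : GOT k n) : T.bulletRow 0 = T.row 0 := rfl

theorem bulletRow_succ (T : GOT k n) (i : Fin k) :
    T.bulletRow i.succ = bottomRow (T.part i.succ) (T.bulletRow i.castSucc) :=
  Fin.induction_succ _ _ i

theorem bottomRow_bulletRow {m : Fin (k + 1)} (hm : m ≠ 0) :
    bottomRow (T.part m) (T.bulletRow m) = T.bulletRow m := by
  obtain ⟨i, rfl⟩ := Fin.exists_succ_eq.2 hm
  rw [bulletRow_succ]
  exact bottomRow_congr (apply_bottomRow _ _)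

include h0

theorem part_succ_zero : T.part (0 : Fin k).succ = Pi.single (T.row 0) 1 := by
  rw [T.part_succ, Fin.castSucc_zero', T.part_zero, h0, zero_add]
  rfl

theorem bulletRow_succ_zero : T.bulletRow (0 : Fin k).succ = T.row 0 := by
  rw [bulletRow_succ, Fin.castSucc_zero', bulletRow_zero]
  refine bottomRow_eq_of_lt rfl fun t ht => ?_
  rw [part_succ_zero h0]
  simp [ht.ne']

theorem newRow_eq_swap {i : Fin k} (hi : i ≠ 0) :
    T.newRow i = Equiv.swap (T.bulletRow i.castSucc) (T.bulletRow i.succ) (T.row i) := by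
  obtain _ | k := k
  · exact i.elim0
  obtain ⟨i, rfl⟩ := Fin.exists_succ_eq.2 hi
  have hfold : T.slideAll = Fin.foldl k (fun F j => T.slide j.succ F) T.startFilling := by
    rw [slideAll, List.finRange_succ, List.tail_cons, List.foldl_map, Fin.foldl_eq_foldl_finRange]
  have invariant := foldl_fin_induction (f := fun F (j : Fin k) => T.slide j.succ F)
    (x := T.startFilling)
    (P := fun m F => F.bullet = (T.bulletRow m.succ, T.part m.succ (T.bulletRow m.succ)) ∧
      ∀ j : Fin k, (m ≤ j.castSucc → F.entry j.succ = T.box j.succ) ∧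
        (j.castSucc < m → (F.entry j.succ).1 =
          Equiv.swap (T.bulletRow j.succ.castSucc) (T.bulletRow j.succ.succ) (T.row j.succ)))
    ⟨?_, fun j => ⟨fun _ => rfl, fun h => absurd h (Fin.not_lt_zero _)⟩⟩ ?_
  · rw [newRow, hfold]
    exact (invariant.2 i).2 (Fin.castSucc_lt_last i)
  · have := bulletRow_succ_zero h0
    simp_all [startFilling, box]
  · rintro j F ⟨hbullet, hentry⟩
    obtain ⟨hbullet', hentry'⟩ := slide_bullet_and_entry h0 ((hentry j).1 le_rfl) hbullet
      (bottomRow_bulletRow (Fin.castSucc_ne_zero_iff.2 (Fin.succ_ne_zero j)))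
    refine ⟨hbullet', fun j' => ⟨fun h => ?_, fun h => ?_⟩⟩
    · have hlt : j < j' := Fin.succ_le_castSucc_iff.1 h
      rw [slide_entry_of_ne ((Fin.succ_injective _).ne hlt.ne'), (hentry j').1 hlt.le]
    · rcases (Fin.castSucc_lt_succ_iff.1 h).eq_or_lt with rfl | hlt
      · exact hentry'
      · rw [slide_entry_of_ne ((Fin.succ_injective _).ne hlt.ne)]
        exact (hentry j').2 hlt

/-- The direction rule for an entry that changes row: up by one row if it is unprimed, down by one
row if it is primed. -/
def MovesByOneRow (T : GOT k n) (i : Fin k) : Prop :=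
  (T.primed i = false → (T.newRow i).val + 1 = (T.row i).val) ∧
    (T.primed i = true → (T.newRow i).val = (T.row i).val + 1)

theorem not_changesRow_of_bulletRow_eq {i : Fin k} (hi : i ≠ 0)
    (h : T.bulletRow i.succ = T.bulletRow i.castSucc) : ¬ T.ChangesRow i := by
  rw [ChangesRow, newRow_eq_swap h0 hi, h, Equiv.swap_self]
  simp

theorem changesRow_and_movesByOneRow {i : Fin k} (hi : i ≠ 0)
    (h : (T.bulletRow i.succ).val = (T.bulletRow i.castSucc).val + 1) :
    T.ChangesRow i ∧ T.MovesByOneRow i := by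
  have hne : bottomRow (T.part i.succ) (T.bulletRow i.castSucc) ≠ T.bulletRow i.castSucc := by
    rw [← bulletRow_succ]
    exact Fin.ne_of_val_ne (by omega)
  have hr := bottomRow_bulletRow (T := T) (Fin.castSucc_ne_zero_iff.2 hi)
  rw [ChangesRow, MovesByOneRow, newRow_eq_swap h0 hi, Fin.ne_iff_vne]
  cases hp : T.primed i
  · have hrow : T.row i = T.bulletRow i.succ := by
      rw [bulletRow_succ, T.bottomRow_succ_of_unprimed hr hp]
      rw [T.bottomRow_succ_of_unprimed hr hp] at hne
      exact (if_pos (by_contra fun h => hne (if_neg h))).symm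
    simp [hrow, h]
  · have hrow : T.row i = T.bulletRow i.castSucc :=
      by_contra fun hrow => hne (T.bottomRow_succ_of_primed hr hp hrow)
    simp [hrow, h]

omit h0

theorem movesByOneRow_dual (T : GOT k n) (i : Fin k) :
    T.dual.MovesByOneRow i ↔ T.MovesByOneRow i := by
  have hrow : T.dual.row i = (T.row i).rev := rfl
  have hprimed : T.dual.primed i = !T.primed i := rfl
  rw [MovesByOneRow, MovesByOneRow, newRow_dual, hrow, hprimed]
  cases T.primed i <;>
    simp only [Bool.not_true, Bool.not_false, Bool.true_eq_false, Bool.false_eq_true, false_imp_iff,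
      true_imp_iff, true_and, and_true, Fin.val_rev] <;>
    omega

end BulletRow

section ThreeRows

theorem firstEqualities_dual {k : ℕ} {T : GOT k 3} {p q : Fin 2} {a b : Fin (k + 1)} :
    T.dual.FirstEqualities p q a b ↔ T.FirstEqualities p.rev q.rev a b := by
  have hset (c : Fin (k + 1)) (p : Fin 2) :
      {i | c < i ∧ T.dual.part i p.castSucc = T.dual.part i p.succ} =
        {i | c < i ∧ T.part i p.rev.castSucc = T.part i p.rev.succ} := by
    ext i
    simp [dual, Fin.rev_castSucc, Fin.rev_succ, eq_comm]
  rw [FirstEqualities, FirstEqualities, hset, hset]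

variable {k : ℕ} [NeZero k] {T : GOT k 3} {a b : Fin (k + 1)}

/-- The lattice path of the tableau returns to the origin at some step before leaving the translate
of the dominant chamber by its first step. For the tableau of a web this makes the leftmost vertex
part of an identity web. -/
def ReturnsInTranslatedChamber (T : GOT k 3) : Prop :=
  ∃ i : Fin k, (∀ r s, T.part i.succ r = T.part i.succ s) ∧
    ∀ m, 0 < m → m < i.succ → Antitone (T.part m - T.part (0 : Fin k).succ)

theorem returnsInTranslatedChamber_of_dual (h : T.dual.ReturnsInTranslatedChamber) :
    T.ReturnsInTranslatedChamber := by
  obtain ⟨i, hconst, hchamber⟩ := h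
  refine ⟨i, fun r s => ?_, fun m hm hmi r s hrs => ?_⟩
  · simpa [dual] using hconst r.rev s.rev
  · have := hchamber m hm hmi (Fin.rev_le_rev.2 hrs)
    simp only [dual, Pi.sub_apply, Fin.rev_rev] at this ⊢
    omega

section Unprimed

variable (h0 : T.primed 0 = false)

include h0

theorem row_zero_eq_zero : T.row 0 = 0 := by
  by_contra h
  have := T.part_antitone (0 : Fin k).succ (Fin.zero_le (T.row 0))
  rw [part_succ_zero h0] at this
  simp [Ne.symm h] at this

variable (hreturn : ¬ T.ReturnsInTranslatedChamber)

include hreturn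

theorem second_ne_third_of_isLeast (ha : IsLeast {i | 0 < i ∧ T.part i 0 = T.part i 1} a) :
    T.part a 1 ≠ T.part a 2 := by
  intro h12
  obtain ⟨i, rfl⟩ := Fin.exists_succ_eq.2 ha.1.1.ne'
  refine hreturn ⟨i, ?_, fun m hm hmi => ?_⟩
  · have := ha.1.2
    simp only [Fin.forall_fin_succ, Fin.succ_zero_eq_one, Fin.succ_one_eq_two,
      IsEmpty.forall_iff, and_true, true_and]
    omega
  · have hne : T.part m 0 ≠ T.part m 1 := fun h => (ha.2 ⟨hm, h⟩).not_gt hmi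
    have h01 := T.part_antitone m (Fin.zero_le 1)
    have h12 := T.part_antitone m (show (1 : Fin 3) ≤ 2 by decide)
    rw [part_succ_zero h0, row_zero_eq_zero h0, Fin.antitone_iff_succ_le, Fin.forall_fin_two]
    change T.part m 1 - 0 ≤ T.part m 0 - 1 ∧ T.part m 2 - 0 ≤ T.part m 1 - 0
    omega

theorem exists_firstEqualities (hlast : ∀ r s, T.part (Fin.last k) r = T.part (Fin.last k) s) :
    ∃ a b, T.FirstEqualities 0 1 a b := by
  have hleast (c : Fin (k + 1)) (hc : c < Fin.last k) (r s : Fin 3) :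
      ∃ a, IsLeast {i | c < i ∧ T.part i r = T.part i s} a :=
    ⟨_, isLeast_csInf ⟨Fin.last k, hc, hlast r s⟩⟩
  obtain ⟨a, ha⟩ := hleast 0 (Fin.last_pos') 0 1
  have ha_lt : a < Fin.last k :=
    Fin.lt_last_iff_ne_last.2 fun h => second_ne_third_of_isLeast h0 hreturn ha (h ▸ hlast 1 2)
  obtain ⟨b, hb⟩ := hleast a ha_lt 1 2
  exact ⟨a, b, ha, hb⟩

theorem bulletRow_eq (hab : T.FirstEqualities 0 1 a b) (m : Fin (k + 1)) :
    T.bulletRow m = if m < a then 0 else if m < b then 1 else 2 := by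
  have ha : T.part a 0 = T.part a 1 := hab.1.1.2
  have hb : T.part b 1 = T.part b 2 := hab.2.1.2
  have hlt : a < b := hab.2.1.1
  have stay_zero {m} (h0 : 0 < m) (h : m < a) : bottomRow (T.part m) 0 = 0 :=
    bottomRow_castSucc_of_ne (r := (0 : Fin 2)) (T.part_antitone m)
      fun h' => (hab.1.2 ⟨h0, h'⟩).not_gt h
  have stay_one {m} (ham : a ≤ m) (hmb : m < b) : bottomRow (T.part m) 1 = 1 := by
    refine bottomRow_castSucc_of_ne (r := (1 : Fin 2)) (T.part_antitone m) fun h => ?_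
    rcases ham.eq_or_lt with rfl | ham
    · exact second_ne_third_of_isLeast h0 hreturn hab.1 h
    · exact (hab.2.2 ⟨ham, h⟩).not_gt hmb
  have stay_two (m) : bottomRow (T.part m) 2 = 2 := le_antisymm (Fin.le_last _) (le_bottomRow rfl)
  induction m using Fin.induction with
  | zero => rw [bulletRow_zero, row_zero_eq_zero h0, if_pos hab.1.1.1]
  | succ i ih =>
    rw [bulletRow_succ, ih]
    have hi : i.castSucc < i.succ := Fin.castSucc_lt_succ
    rcases lt_trichotomy i.succ a with h | h | h
    · rw [if_pos (hi.trans h), if_pos h, stay_zero (Fin.succ_pos i) h]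
    · rw [if_pos (h ▸ hi), if_neg h.not_lt, if_pos (h ▸ hlt), bottomRow_congr (h ▸ ha), h,
        stay_one le_rfl hlt]
    have hai : a ≤ i.castSucc := Fin.le_castSucc_iff.2 h
    rw [if_neg hai.not_gt, if_neg h.not_gt]
    rcases lt_trichotomy i.succ b with h' | h' | h'
    · rw [if_pos (hi.trans h'), if_pos h', stay_one h.le h']
    · rw [if_pos (h' ▸ hi), if_neg h'.not_lt, bottomRow_congr (h' ▸ hb), stay_two]
    · rw [if_neg (Fin.le_castSucc_iff.2 h').not_gt, if_neg h'.not_gt, stay_two]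

theorem bulletRow_succ_val (hab : T.FirstEqualities 0 1 a b) (i : Fin k) :
    (T.bulletRow i.succ).val =
      (T.bulletRow i.castSucc).val + if i.succ = a ∨ i.succ = b then 1 else 0 := by
  have hlt : a < b := hab.2.1.1
  rw [bulletRow_eq h0 hreturn hab, bulletRow_eq h0 hreturn hab]
  simp only [Fin.lt_def, Fin.ext_iff, Fin.val_succ, Fin.val_castSucc] at hlt ⊢
  split_ifs <;> first | rfl | omega

theorem changesRow_iff (hab : T.FirstEqualities 0 1 a b) {i : Fin k} (hi : i ≠ 0) :
    (T.ChangesRow i ↔ i.succ = a ∨ i.succ = b) ∧ (T.ChangesRow i → T.MovesByOneRow i) := by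
  have hrow := bulletRow_succ_val h0 hreturn hab i
  by_cases h : i.succ = a ∨ i.succ = b
  · rw [if_pos h] at hrow
    obtain ⟨hchanges, hmoves⟩ := changesRow_and_movesByOneRow h0 hi hrow
    exact ⟨iff_of_true hchanges h, fun _ => hmoves⟩
  · rw [if_neg h] at hrow
    have hchanges := not_changesRow_of_bulletRow_eq h0 hi (Fin.ext hrow)
    exact ⟨iff_of_false hchanges h, fun h => absurd h hchanges⟩

end Unprimed

theorem exists_changesRow_iff_of_unprimed
    (hlast : ∀ r s, T.part (Fin.last k) r = T.part (Fin.last k) s)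
    (hreturn : ¬ T.ReturnsInTranslatedChamber) (h0 : T.primed 0 = false) :
    ∃ a b, T.FirstEqualities 0 1 a b ∧ ∀ i : Fin k, i ≠ 0 →
      (T.ChangesRow i ↔ i.succ = a ∨ i.succ = b) ∧ (T.ChangesRow i → T.MovesByOneRow i) := by
  obtain ⟨a, b, hab⟩ := exists_firstEqualities h0 hreturn hlast
  exact ⟨a, b, hab, fun i hi => changesRow_iff h0 hreturn hab hi⟩

theorem exists_changesRow_iff_of_primed
    (hlast : ∀ r s, T.part (Fin.last k) r = T.part (Fin.last k) s)
    (hreturn : ¬ T.ReturnsInTranslatedChamber) (h0 : T.primed 0 = true) :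
    ∃ a b, T.FirstEqualities 1 0 a b ∧ ∀ i : Fin k, i ≠ 0 →
      (T.ChangesRow i ↔ i.succ = a ∨ i.succ = b) ∧ (T.ChangesRow i → T.MovesByOneRow i) := by
  obtain ⟨a, b, hab, hrow⟩ := exists_changesRow_iff_of_unprimed (T := T.dual)
    (fun r s => congrArg Neg.neg (hlast r.rev s.rev))
    (mt returnsInTranslatedChamber_of_dual hreturn) (by simp [dual, h0])
  simp only [changesRow_dual, movesByOneRow_dual] at hrow
  exact ⟨a, b, firstEqualities_dual.1 hab, hrow⟩

end ThreeRows

section Webs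

variable {k : ℕ} {T : GOT k 3} {D : Web k}

/-- The weight of `sl(3)` given by a generalized partition, in the basis of `Web.weight`. -/
def weightOfPart : (Fin 3 → ℤ) →+ ℤ × ℤ where
  toFun p := (p 0 - p 1, p 1 - p 2)
  map_zero' := by simp
  map_add' p q := by ext <;> simp <;> ring

theorem weightOfPart_nonneg_iff {p : Fin 3 → ℤ} : 0 ≤ weightOfPart p ↔ Antitone p := by
  rw [Fin.antitone_iff_succ_le]
  simp [weightOfPart, Prod.le_def, Fin.forall_fin_succ]

theorem weightOfPart_eq_zero_iff {p : Fin 3 → ℤ} : weightOfPart p = 0 ↔ ∀ r s, p r = p s := by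
  simp only [weightOfPart, AddMonoidHom.coe_mk, ZeroHom.coe_mk, Prod.ext_iff, Prod.fst_zero,
    Prod.snd_zero, Fin.forall_fin_succ, Fin.succ_zero_eq_one, Fin.succ_one_eq_two,
    IsEmpty.forall_iff, and_true, true_and]
  omega

theorem weightOfPart_single (s : WebState) (c : WebColor) :
    weightOfPart (Pi.single s.row (if c = .white then -1 else 1)) = Web.weight s c := by
  cases s <;> cases c <;> simp [weightOfPart, WebState.row, Web.weight]

variable {j : Fin k → WebState}
  (hT : ∀ i, T.row i = (j i).row ∧ (T.primed i = true ↔ D.signature i = .white))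

include hT

theorem weightOfPart_part (m : Fin (k + 1)) :
    weightOfPart (T.part m) = Fin.partialSum (fun i => Web.weight (j i) (D.signature i)) m := by
  induction m using Fin.induction with
  | zero => rw [T.part_zero, map_zero, Fin.partialSum_zero]
  | succ i ih =>
    rw [T.part_succ, map_add, ih, Fin.partialSum_succ, (hT i).1, ← weightOfPart_single]
    simp only [(hT i).2]

omit hT

theorem ComesFrom.part_last (hT : T.ComesFrom D) (r s : Fin 3) :
    T.part (Fin.last k) r = T.part (Fin.last k) s := by
  obtain ⟨j, hj, hT⟩ := hT
  refine weightOfPart_eq_zero_iff.1 ?_ r s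
  rw [weightOfPart_part hT, hj.1.partialSum_last]

theorem ComesFrom.not_returnsInTranslatedChamber [NeZero k] (hT : T.ComesFrom D)
    (hD : ∀ i, D.opp (D.bdry 0) ≠ D.bdry i) : ¬ T.ReturnsInTranslatedChamber := by
  rintro ⟨n, hconst, hchamber⟩
  obtain ⟨j, hj, hT⟩ := hT
  have hfirst : weightOfPart (T.part (0 : Fin k).succ) = Web.weight (j 0) (D.signature 0) := by
    rw [weightOfPart_part hT, Fin.partialSum_succ, Fin.castSucc_zero', Fin.partialSum_zero,
      zero_add]
  refine hD n (hj.opp_bdry_zero ?_ fun m hm hmn => ?_)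
  · rw [← weightOfPart_part hT]
    exact weightOfPart_eq_zero_iff.2 hconst
  · rw [← weightOfPart_part hT, ← hfirst, ← sub_nonneg, ← map_sub]
    exact weightOfPart_nonneg_iff.2 (hchamber m hm hmn)

end Webs

end GOT

theorem mainTheorem4_general (k : ℕ) [NeZero k] (D : Web k)
    (hD : ∀ i, D.opp (D.bdry 0) ≠ D.bdry i) (T : GOT k 3) (hT : T.ComesFrom D) :
    (D.color (D.bdry 0) = .black →
      ∃ a b, T.FirstEqualities 0 1 a b ∧
        ∀ i : Fin k, i ≠ 0 → (T.ChangesRow i ↔ i.succ = a ∨ i.succ = b)) ∧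
    (D.color (D.bdry 0) = .white →
      ∃ a b, T.FirstEqualities 1 0 a b ∧
        ∀ i : Fin k, i ≠ 0 → (T.ChangesRow i ↔ i.succ = a ∨ i.succ = b)) ∧
    (∀ i : Fin k, i ≠ 0 → T.ChangesRow i →
      (T.primed i = false → (T.newRow i).val + 1 = (T.row i).val) ∧
      (T.primed i = true → (T.newRow i).val = (T.row i).val + 1)) := by
  have hlast := hT.part_last
  have hreturn := hT.not_returnsInTranslatedChamber hD
  obtain ⟨j, -, hT⟩ := hT
  have hprimed : T.primed 0 = true ↔ D.color (D.bdry 0) = .white := (hT 0).2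
  cases h0 : T.primed 0
  · have hcolor : D.color (D.bdry 0) ≠ .white := fun h => by simp [hprimed.2 h] at h0
    obtain ⟨a, b, hab, hrow⟩ := GOT.exists_changesRow_iff_of_unprimed hlast hreturn h0
    exact ⟨fun _ => ⟨a, b, hab, fun i hi => (hrow i hi).1⟩, fun h => absurd h hcolor,
      fun i hi => (hrow i hi).2⟩
  · have hcolor : D.color (D.bdry 0) ≠ .black := by simp [hprimed.1 h0]
    obtain ⟨a, b, hab, hrow⟩ := GOT.exists_changesRow_iff_of_primed hlast hreturn h0
    exact ⟨fun h => absurd h hcolor, fun _ => ⟨a, b, hab, fun i hi => (hrow i hi).1⟩,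
      fun i hi => (hrow i hi).2⟩

theorem mainTheorem4 (k : ℕ) [NeZero k] (D : Web k) (hD : ¬ D.ContainsIdentity)
    (T : GOT k 3) (hT : T.ComesFrom D) :
    (D.color (D.bdry 0) = .black →
      ∃ a b, T.FirstEqualities 0 1 a b ∧
        ∀ i : Fin k, i ≠ 0 → (T.ChangesRow i ↔ i.succ = a ∨ i.succ = b)) ∧
    (D.color (D.bdry 0) = .white →
      ∃ a b, T.FirstEqualities 1 0 a b ∧
        ∀ i : Fin k, i ≠ 0 → (T.ChangesRow i ↔ i.succ = a ∨ i.succ = b)) ∧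
    (∀ i : Fin k, i ≠ 0 → T.ChangesRow i →
      (T.primed i = false → (T.newRow i).val + 1 = (T.row i).val) ∧
      (T.primed i = true → (T.newRow i).val = (T.row i).val + 1)) :=
  mainTheorem4_general k D (fun i hi => hD ⟨0, i, hi⟩) T hT
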